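/- **Proposition.** Let $X$ be a scheme, let $\mathrm{QCoh}(X)$ be the category of quasicoherent sheaves of $\mathcal O_X$-modules, and let $\otimes$ be the usual tensor product of sheaves of $\mathcal O_X$-modules. For $\mathcal A,\mathcal E\in\mathrm{QCoh}(X)$, let $\mathcal{H}om^{\mathrm{qc}}(\mathcal A,\mathcal E)$ denote the internal hom of $\mathrm{QCoh}(X)$, i.e. the quasicoherent sheaf (unique up to unique isomorphism) such that $$\mathrm{Hom}\bigl(\mathcal T,\mathcal{H}om^{\mathrm{qc}}(\mathcal A,\mathcal E)\bigr)\;\cong\;\mathrm{Hom}(\mathcal T\otimes\mathcal A,\mathcal E)$$ naturally in $\mathcal T\in\mathrm{QCoh}(X)$; it is contravariantly functorial in $\mathcal A$. Let $\mathcal E$ be an injective object of $\mathrm{QCoh}(X)$ which is also an injective object of the category of all sheaves of $\mathcal O_X$-modules. Then $\mathcal{H}om^{\mathrm{qc}}(-,\mathcal E)$ is exact on short exact sequences of quasicoherent sheaves of finite type. That is, $\mathcal{H}om^{\mathrm{qc}}(\mathcal A,\mathcal E)$ exists for every quasicoherent sheaf $\mathcal A$ of finite type, and for every short exact sequence $$0\to\mathcal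 A\to\mathcal B\to\mathcal C\to 0$$ in $\mathrm{QCoh}(X)$ with $\mathcal A,\mathcal B,\mathcal C$ of finite type, the induced sequence $$0\to\mathcal{H}om^{\mathrm{qc}}(\mathcal C,\mathcal E)\to\mathcal{H}om^{\mathrm{qc}}(\mathcal B,\mathcal E)\to\mathcal{H}om^{\mathrm{qc}}(\mathcal A,\mathcal E)\to 0$$ is short exact in $\mathrm{QCoh}(X)$. -/

import Mathlib

universe u

open CategoryTheory Limits MonoidalCategory Opposite

namespace AlgebraicGeometry.Scheme

noncomputable section

/-- The property of being quasicoherent, for sheaves of `𝒪_X`-modules. -/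
abbrev isQuasicoherent (X : Scheme.{u}) : ObjectProperty X.Modules :=
  fun M ↦ SheafOfModules.IsQuasicoherent (R := X.ringCatSheaf) M

/-- The category of quasicoherent sheaves on `X`, as the full subcategory of the category of
sheaves of `𝒪_X`-modules consisting of the quasicoherent ones. -/
abbrev QCoh (X : Scheme.{u}) : Type (u + 1) := (isQuasicoherent X).FullSubcategory

/-- A sheaf of `𝒪_X`-modules is of finite type if it is locally generated by finitely many
sections. -/
abbrev Modules.IsFiniteType {X : Scheme.{u}} (M : X.Modules) : Prop :=
  SheafOfModules.IsFiniteType (R := X.ringCatSheaf) M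

namespace Modules

variable {X : Scheme.{u}}

/-- The sheafification functor from presheaves of `𝒪_X`-modules to sheaves of `𝒪_X`-modules. -/
def sheafification (X : Scheme.{u}) : X.PresheafOfModules ⥤ X.Modules :=
  PresheafOfModules.sheafification (𝟙 X.ringCatSheaf.obj)

/-- The tensor product of the underlying presheaves of modules:
`U ↦ Γ(M, U) ⊗ Γ(N, U)`, the tensor product being taken over `Γ(X, U)`. -/
def presheafTensorObj (M N : X.Modules) : X.PresheafOfModules :=
  MonoidalCategory.tensorObj
    (C := _root_.PresheafOfModules.{u} (X.presheaf ⋙ forget₂ CommRingCat RingCat)) M.val N.val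

/-- The functoriality of the presheaf tensor product. -/
def presheafTensorMap {M M' N N' : X.Modules} (f : M ⟶ M') (g : N ⟶ N') :
    presheafTensorObj M N ⟶ presheafTensorObj M' N' :=
  MonoidalCategory.tensorHom
    (C := _root_.PresheafOfModules.{u} (X.presheaf ⋙ forget₂ CommRingCat RingCat)) f.val g.val

/-- The tensor product of two sheaves of `𝒪_X`-modules: the sheaf associated with
`U ↦ Γ(M, U) ⊗ Γ(N, U)`. -/
def tensorObj (M N : X.Modules) : X.Modules :=
  (sheafification X).obj (presheafTensorObj M N)

/-- The tensor product of two morphisms of sheaves of `𝒪_X`-modules. -/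
def tensorMap {M M' N N' : X.Modules} (f : M ⟶ M') (g : N ⟶ N') :
    tensorObj M N ⟶ tensorObj M' N' :=
  (sheafification X).map (presheafTensorMap f g)

lemma tensorMap_id (M N : X.Modules) : tensorMap (𝟙 M) (𝟙 N) = 𝟙 (tensorObj M N) := by
  have h : presheafTensorMap (𝟙 M) (𝟙 N) = 𝟙 _ :=
    MonoidalCategory.id_tensorHom_id
      (C := _root_.PresheafOfModules.{u} (X.presheaf ⋙ forget₂ CommRingCat RingCat)) _ _
  rw [tensorMap, h]
  exact (sheafification X).map_id _

lemma tensorMap_comp {M M' M'' N N' N'' : X.Modules} (f : M ⟶ M') (f' : M' ⟶ M'')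
    (g : N ⟶ N') (g' : N' ⟶ N'') :
    tensorMap (f ≫ f') (g ≫ g') = tensorMap f g ≫ tensorMap f' g' := by
  have h : presheafTensorMap (f ≫ f') (g ≫ g') =
      presheafTensorMap f g ≫ presheafTensorMap f' g' :=
    (MonoidalCategory.tensorHom_comp_tensorHom
      (C := _root_.PresheafOfModules.{u} (X.presheaf ⋙ forget₂ CommRingCat RingCat))
      _ _ _ _).symm
  rw [tensorMap, h]
  exact (sheafification X).map_comp _ _

lemma sheafification_map_zero (P Q : X.PresheafOfModules) :
    (sheafification X).map (0 : P ⟶ Q) = 0 :=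
  haveI : (PresheafOfModules.sheafification (𝟙 X.ringCatSheaf.obj)).PreservesZeroMorphisms :=
    Functor.preservesZeroMorphisms_of_isLeftAdjoint _
  Functor.map_zero (PresheafOfModules.sheafification (𝟙 X.ringCatSheaf.obj)) P Q

lemma tensorMap_zero_left {M M' N N' : X.Modules} (g : N ⟶ N') :
    tensorMap (0 : M ⟶ M') g = 0 := by
  have h : presheafTensorMap (0 : M ⟶ M') g = 0 := by
    ext1 U
    exact ModuleCat.MonoidalCategory.tensor_ext (fun m n ↦ TensorProduct.zero_tmul _ _)
  rw [tensorMap, h, sheafification_map_zero]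
  rfl

lemma tensorMap_zero_right {M M' N N' : X.Modules} (f : M ⟶ M') :
    tensorMap f (0 : N ⟶ N') = 0 := by
  have h : presheafTensorMap f (0 : N ⟶ N') = 0 := by
    ext1 U
    exact ModuleCat.MonoidalCategory.tensor_ext (fun m n ↦ TensorProduct.tmul_zero _ _)
  rw [tensorMap, h, sheafification_map_zero]
  rfl

end Modules

namespace QCoh

variable {X : Scheme.{u}}

/-- The functor `T ↦ T ⊗ A` on quasicoherent sheaves. Since `QCoh X` is a full subcategory, it is
enough for the adjunction below to let it take values in all sheaves of `𝒪_X`-modules. -/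
@[simps]
def tensorRight (A : QCoh X) : QCoh X ⥤ X.Modules where
  obj T := Modules.tensorObj T.obj A.obj
  map f := Modules.tensorMap f.hom (𝟙 A.obj)
  map_id T := Modules.tensorMap_id _ _
  map_comp f g := by
    rw [← Modules.tensorMap_comp, Category.comp_id]
    rfl

/-- An internal hom `Hom^qc(A, E)` in the category of quasicoherent sheaves: a quasicoherent sheaf
`obj` with bijections `(T ⟶ obj) ≃ (T ⊗ A ⟶ E)`, natural in the quasicoherent sheaf `T`. In
other words, it is the value at `E` of the right adjoint of `- ⊗ A`; it is determined by `A` and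
`E` up to a unique isomorphism. -/
structure InternalHom (A E : QCoh X) where
  /-- the quasicoherent sheaf `Hom^qc(A, E)` -/
  obj : QCoh X
  /-- the tensor-hom adjunction -/
  adj : ((tensorRight A).op ⋙ yoneda.obj E.obj).RepresentableBy obj

namespace InternalHom

variable {A B C E : QCoh X}

/-- The evaluation morphism `Hom^qc(A, E) ⊗ A ⟶ E`. -/
def ev (H : InternalHom A E) : Modules.tensorObj H.obj.obj A.obj ⟶ E.obj :=
  H.adj.homEquiv (𝟙 H.obj)

/-- The contravariant functoriality of `Hom^qc(-, E)`: the morphism `Hom^qc(B, E) ⟶ Hom^qc(A, E)`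
induced by `f : A ⟶ B`, which corresponds by adjunction to the composition
`Hom^qc(B, E) ⊗ A ⟶ Hom^qc(B, E) ⊗ B ⟶ E`. -/
def map (f : A ⟶ B) (HB : InternalHom B E) (HA : InternalHom A E) : HB.obj ⟶ HA.obj :=
  HA.adj.homEquiv.symm (Modules.tensorMap (𝟙 HB.obj.obj) f.hom ≫ HB.ev)

lemma homEquiv_eq (H : InternalHom A E) {T : QCoh X} (φ : T ⟶ H.obj) :
    H.adj.homEquiv φ = Modules.tensorMap φ.hom (𝟙 A.obj) ≫ H.ev :=
  H.adj.homEquiv_eq φ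

lemma map_ev (f : A ⟶ B) (HB : InternalHom B E) (HA : InternalHom A E) :
    Modules.tensorMap (map f HB HA).hom (𝟙 A.obj) ≫ HA.ev =
      Modules.tensorMap (𝟙 HB.obj.obj) f.hom ≫ HB.ev := by
  rw [← homEquiv_eq]
  exact Equiv.apply_symm_apply _ _

lemma map_comp_map (f : A ⟶ B) (g : B ⟶ C) (HC : InternalHom C E) (HB : InternalHom B E)
    (HA : InternalHom A E) : map g HC HB ≫ map f HB HA = map (f ≫ g) HC HA := by
  apply HA.adj.homEquiv.injective
  rw [homEquiv_eq, homEquiv_eq, map_ev]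
  have e₁ : Modules.tensorMap (map g HC HB ≫ map f HB HA).hom (𝟙 A.obj) =
      Modules.tensorMap (map g HC HB).hom (𝟙 A.obj) ≫
        Modules.tensorMap (map f HB HA).hom (𝟙 A.obj) := by
    rw [← Modules.tensorMap_comp, Category.comp_id]
    rfl
  have e₂ : Modules.tensorMap (map g HC HB).hom (𝟙 A.obj) ≫
      Modules.tensorMap (𝟙 HB.obj.obj) f.hom =
      Modules.tensorMap (𝟙 HC.obj.obj) f.hom ≫
        Modules.tensorMap (map g HC HB).hom (𝟙 B.obj) := by
    rw [← Modules.tensorMap_comp, ← Modules.tensorMap_comp, Category.comp_id, Category.comp_id,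
      Category.id_comp, Category.id_comp]
  have e₃ : Modules.tensorMap (𝟙 HC.obj.obj) (f ≫ g).hom =
      Modules.tensorMap (𝟙 HC.obj.obj) f.hom ≫ Modules.tensorMap (𝟙 HC.obj.obj) g.hom := by
    rw [← Modules.tensorMap_comp, Category.comp_id]
    rfl
  rw [e₁, Category.assoc, map_ev, ← Category.assoc, e₂, Category.assoc, map_ev, e₃,
    Category.assoc]

lemma map_zero (HB : InternalHom B E) (HA : InternalHom A E) :
    map (0 : A ⟶ B) HB HA = 0 := by
  apply HA.adj.homEquiv.injective
  rw [homEquiv_eq, homEquiv_eq, map_ev]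
  have e₁ : Modules.tensorMap (𝟙 HB.obj.obj) (0 : A ⟶ B).hom = 0 :=
    Modules.tensorMap_zero_right _
  have e₂ : Modules.tensorMap (0 : HB.obj ⟶ HA.obj).hom (𝟙 A.obj) = 0 :=
    Modules.tensorMap_zero_left _
  rw [e₁, e₂, zero_comp, zero_comp]

/-- The complex `Hom^qc(C, E) ⟶ Hom^qc(B, E) ⟶ Hom^qc(A, E)` obtained by applying
`Hom^qc(-, E)` to a complex `A ⟶ B ⟶ C` of quasicoherent sheaves. -/
@[simps]
def shortComplex (S : ShortComplex (QCoh X)) (H₁ : InternalHom S.X₁ E) (H₂ : InternalHom S.X₂ E)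
    (H₃ : InternalHom S.X₃ E) : ShortComplex (QCoh X) where
  X₁ := H₃.obj
  X₂ := H₂.obj
  X₃ := H₁.obj
  f := map S.g H₃ H₂
  g := map S.f H₂ H₁
  zero := by rw [map_comp_map, S.zero, map_zero]

end InternalHom

end QCoh

end

end AlgebraicGeometry.Scheme

/-!
Write `Hom(A, E)` for the sheaf `U ↦ Hom(A|_U, E|_U)`. It is the internal hom in the category of
all sheaves of modules (`tensorHomEquiv`, `Bilin.curry`), so it is an internal hom for quasicoherent
sheaves as soon as it is quasicoherent. The injectivity of `E` among all sheaves of modules enters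
through the following fact (`LocalHom.exists_hom`): every morphism `A|_V ⟶ E|_V` extends to a
morphism `A ⟶ E`. Indeed it defines a morphism to `E` from the subpresheaf of `A` whose sections
over `W` are `A(W)` if `W ≤ V` and zero otherwise, and `E` is also injective as a presheaf.

*Existence.* A sheaf is quasicoherent if and only if it is localizing on affine opens `U`, that is,
if the restriction maps from `U` to `D(f)` have the surjectivity and injectivity properties of a
localization (`isQuasicoherent_iff_isLocalizingOn`). For `Hom(A, E)`, surjectivity holds because
all restriction maps are surjective by the fact above. If `A` is generated on `U` by finitely many
sections, a morphism `φ : A|_U ⟶ E|_U` is determined by its values on them; if `φ` vanishes on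
`D(f)`, these values are killed by a power of `f`, because `E` is localizing, and hence so is `φ`
(`isQuasicoherent_sheafHom`).

*Exactness.* Quasicoherent sheaves are closed under kernels and cokernels, so a short exact sequence
`0 ⟶ A ⟶ B ⟶ C ⟶ 0` of them is exact as a sequence of sheaves of modules. Morphisms from `T` to the
internal hom of `A` and `E` are pairings `T × A → E`, or morphisms from `A` to `Hom(T, E)`, so left
exactness is the universal property of the cokernel `C` (`exact_shortComplex`). If `A ⟶ B` is a
monomorphism, then `Hom(B, E) ⟶ Hom(A, E)` is surjective on the sections over every open subset:
extend a morphism `A|_U ⟶ E|_U` to `A ⟶ E`, and then to `B ⟶ E` (`sheafHomMap_app_surjective`).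
-/

/-! ### Quasicoherence in terms of sections over affine opens -/

namespace AlgebraicGeometry.Scheme.Modules

variable {X : Scheme.{u}}

/-- A sheaf of modules `M` is localizing on `U` if for every `f ∈ Γ(X, U)` the restriction map
`Γ(M, U) → Γ(M, D(f))` has the surjectivity and injectivity properties of a localization away
from `f`: every section over `D(f)` extends to `U` after multiplication by a power of `f`, and
every section over `U` that vanishes on `D(f)` is killed by a power of `f`. For `U` affine, this
says that `M|_U` is the sheaf associated with the module `Γ(M, U)`. -/
structure IsLocalizingOn (M : X.Modules) (U : X.Opens) : Prop where
  exists_res_eq (f : Γ(X, U)) (s : Γ(M, X.basicOpen f)) : ∃ (n : ℕ) (t : Γ(M, U)),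
    M.presheaf.map (homOfLE (X.basicOpen_le f)).op t =
      X.presheaf.map (homOfLE (X.basicOpen_le f)).op (f ^ n) • s
  exists_pow_smul_eq_zero (f : Γ(X, U)) (t : Γ(M, U))
    (ht : M.presheaf.map (homOfLE (X.basicOpen_le f)).op t = 0) : ∃ n : ℕ, f ^ n • t = 0

lemma fromSpec_appIso_inv {U : X.Opens} (hU : IsAffineOpen U)
    (W : (Spec Γ(X, U)).Opens) (h : hU.fromSpec ''ᵁ W ≤ U) (r : Γ(X, U)) :
    (hU.fromSpec.appIso W).inv ((Spec Γ(X, U)).presheaf.map W.leTop.op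
      ((Scheme.ΓSpecIso Γ(X, U)).inv r)) = X.presheaf.map (homOfLE h).op r := by
  have : (Scheme.ΓSpecIso Γ(X, U)).inv ≫ (Spec Γ(X, U)).presheaf.map W.leTop.op ≫
      (hU.fromSpec.appIso W).inv = X.presheaf.map (homOfLE h).op := by
    rw [← Category.assoc, Iso.comp_inv_eq, Hom.appIso_hom', Hom.map_appLE, Hom.appLE,
      hU.fromSpec_app_self, Category.assoc, ← Functor.map_comp]
    rfl
  exact congr($this r)

/-- The sections over `W` of the restriction of `M` to `Spec Γ(X, U)` are the sections of `M` over
the image `V` of `W`. The image enters as a variable `V` with an equality, so that it may be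
written as `U` or as `D(f)`. -/
noncomputable def restrictFromSpecIso (M : X.Modules) {U : X.Opens} (hU : IsAffineOpen U)
    (W : (Spec Γ(X, U)).Opens) (V : X.Opens) (h : hU.fromSpec ''ᵁ W = V) :
    Γ(M.restrict hU.fromSpec, W) ≅ Γ(M, V) :=
  M.restrictAppIso hU.fromSpec W ≪≫ M.presheaf.mapIso (eqToIso h.symm).op

lemma restrictFromSpecIso_smul (M : X.Modules) {U : X.Opens} (hU : IsAffineOpen U)
    (W : (Spec Γ(X, U)).Opens) (V : X.Opens) (h : hU.fromSpec ''ᵁ W = V) (hV : V ≤ U)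
    (r : Γ(X, U)) (x : Γ(M.restrict hU.fromSpec, W)) :
    (M.restrictFromSpecIso hU W V h).hom (r • x) =
      X.presheaf.map (homOfLE hV).op r • (M.restrictFromSpecIso hU W V h).hom x := by
  subst h
  simp only [restrictFromSpecIso, Iso.trans_hom, smul_Spec_def]
  have := fromSpec_appIso_inv hU W hV r
  rw [← this]
  simp

lemma restrictFromSpecIso_map (M : X.Modules) {U : X.Opens} (hU : IsAffineOpen U)
    {W W' : (Spec Γ(X, U)).Opens} {V V' : X.Opens} (h : hU.fromSpec ''ᵁ W = V)
    (h' : hU.fromSpec ''ᵁ W' = V') (i : W' ⟶ W) (hV : V' ≤ V)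
    (x : Γ(M.restrict hU.fromSpec, W)) :
    (M.restrictFromSpecIso hU W' V' h').hom ((M.restrict hU.fromSpec).presheaf.map i.op x) =
      M.presheaf.map (homOfLE hV).op ((M.restrictFromSpecIso hU W V h).hom x) := by
  subst h h'
  simp only [restrictFromSpecIso, Iso.trans_hom]
  simp

/-- The distinguished open subset `D(f)` of `Spec R`, as an open subset of the scheme. -/
def specBasicOpen {R : CommRingCat.{u}} (f : R) : (Spec R).Opens := PrimeSpectrum.basicOpen f

lemma isLocalizing_iff_forall {R : CommRingCat.{u}} (N : (Spec R).Modules) :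
    IsLocalizing (modulesSpecToSheaf.obj N) ↔ ∀ f : R,
      (∀ s : Γ(N, specBasicOpen f), ∃ (n : ℕ) (t : Γ(N, ⊤)),
        N.presheaf.map (specBasicOpen f).leTop.op t = f ^ n • s) ∧
      (∀ t : Γ(N, ⊤), N.presheaf.map (specBasicOpen f).leTop.op t = 0 →
        ∃ n : ℕ, f ^ n • t = 0) := by
  let φ (f : R) := ((modulesSpecToSheaf.obj N).obj.map (specBasicOpen f).leTop.op).hom
  refine ⟨fun h f ↦ ?_, fun h f ↦ IsLocalizedModule.Away.mk_of_addCommGroup ?_ ?_ ?_⟩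
  · have hf : IsLocalizedModule.Away f (φ f) := h f
    refine ⟨fun s ↦ ?_, fun s hs ↦ ?_⟩
    · obtain ⟨n, y, hy⟩ := hf.surj _ _ s
      exact ⟨n, y, hy.symm⟩
    · obtain ⟨⟨_, n, rfl⟩, hn⟩ := (IsLocalizedModule.eq_zero_iff (.powers f) (φ f)).mp hs
      exact ⟨n, hn⟩
  · exact isUnit_algebraMap_end_of_le_basicOpen f le_rfl
  · intro x
    obtain ⟨n, t, ht⟩ := (h f).1 x
    exact ⟨n, t, ht.symm⟩
  · exact (h f).2

/-- Restriction to the affine scheme `Spec Γ(X, U)` turns `IsLocalizingOn` into the criterion for a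
sheaf on an affine scheme to be associated with a module. -/
lemma isLocalizing_restrict_fromSpec_iff (M : X.Modules) {U : X.Opens} (hU : IsAffineOpen U) :
    IsLocalizing (modulesSpecToSheaf.obj (M.restrict hU.fromSpec)) ↔ M.IsLocalizingOn U := by
  have hT : hU.fromSpec ''ᵁ ⊤ = U := by simp
  have hD (f : Γ(X, U)) : hU.fromSpec ''ᵁ specBasicOpen f = X.basicOpen f :=
    hU.fromSpec_image_basicOpen f
  let eT := M.restrictFromSpecIso hU ⊤ U hT
  let eD (f : Γ(X, U)) := M.restrictFromSpecIso hU _ _ (hD f)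
  have map_e (f : Γ(X, U)) (x) : (eD f).hom ((M.restrict hU.fromSpec).presheaf.map
      (specBasicOpen f).leTop.op x) =
        M.presheaf.map (homOfLE (X.basicOpen_le f)).op (eT.hom x) :=
    M.restrictFromSpecIso_map hU hT (hD f) _ _ x
  have smulT (r : Γ(X, U)) (x) : eT.hom (r • x) = r • eT.hom x :=
    (M.restrictFromSpecIso_smul hU ⊤ U hT le_rfl r x).trans (by simp [eT])
  have smulD (f r : Γ(X, U)) (x) : (eD f).hom (r • x) =
      X.presheaf.map (homOfLE (X.basicOpen_le f)).op r • (eD f).hom x :=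
    M.restrictFromSpecIso_smul hU _ _ (hD f) _ r x
  have injT : Function.Injective eT.hom := (ConcreteCategory.bijective_of_isIso eT.hom).1
  have injD (f : Γ(X, U)) : Function.Injective (eD f).hom :=
    (ConcreteCategory.bijective_of_isIso (eD f).hom).1
  have surjT : Function.Surjective eT.hom := (ConcreteCategory.bijective_of_isIso eT.hom).2
  have surjD (f : Γ(X, U)) : Function.Surjective (eD f).hom :=
    (ConcreteCategory.bijective_of_isIso (eD f).hom).2
  rw [isLocalizing_iff_forall]
  refine ⟨fun h ↦ ⟨fun f s ↦ ?_, fun f t ht ↦ ?_⟩, fun h f ↦ ⟨fun s ↦ ?_, fun t ht ↦ ?_⟩⟩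
  · obtain ⟨s, rfl⟩ := surjD f s
    obtain ⟨n, t, ht⟩ := (h f).1 s
    exact ⟨n, eT.hom t, by rw [← map_e, ht, smulD]⟩
  · obtain ⟨t, rfl⟩ := surjT t
    rw [← map_e] at ht
    obtain ⟨n, hn⟩ := (h f).2 t (injD f (ht.trans (map_zero _).symm))
    exact ⟨n, by rw [← smulT, hn, map_zero]⟩
  · obtain ⟨n, t, ht⟩ := h.exists_res_eq f ((eD f).hom s)
    obtain ⟨t, rfl⟩ := surjT t
    exact ⟨n, t, injD f (by rw [map_e, ht, smulD])⟩
  · obtain ⟨n, hn⟩ := h.exists_pow_smul_eq_zero f (eT.hom t) (by rw [← map_e, ht, map_zero])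
    exact ⟨n, injT (by rw [smulT, hn, map_zero])⟩

lemma isQuasicoherent_restrict_fromSpec_iff (M : X.Modules) {U : X.Opens} (hU : IsAffineOpen U) :
    isQuasicoherent _ (M.restrict hU.fromSpec) ↔ M.IsLocalizingOn U := by
  rw [← isLocalizing_restrict_fromSpec_iff M hU, ← isIso_fromTildeΓ_iff_isLocalizing]
  exact isQuasicoherent_iff_isIso_fromTildeΓ _

lemma IsLocalizingOn.of_isQuasicoherent {M : X.Modules} (hM : isQuasicoherent X M)
    {U : X.Opens} (hU : IsAffineOpen U) : M.IsLocalizingOn U := by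
  rw [← isQuasicoherent_restrict_fromSpec_iff M hU]
  have : SheafOfModules.IsQuasicoherent (R := X.ringCatSheaf) M := hM
  exact isQuasicoherent_restrictFunctor _ _

/-- A presentation of `M` gives one of each sheaf isomorphic to `M`. -/
noncomputable def presentationOfIso {M N : X.Modules} (e : M ≅ N)
    (P : SheafOfModules.Presentation.{u} (R := X.ringCatSheaf) M) :
    SheafOfModules.Presentation.{u} (R := X.ringCatSheaf) N :=
  have : IsIso (C := SheafOfModules.{u} X.ringCatSheaf) (X := M) (Y := N) e.hom :=
    (inferInstance : IsIso e.hom)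
  SheafOfModules.Presentation.ofIsIso.{u, u, u} (R := X.ringCatSheaf) e.hom P

/-- A presentation of the restriction of `M` to the open subscheme `U` is a presentation of the
restriction of `M` to the slice site over `U`, in terms of which quasicoherence is defined. -/
noncomputable def presentationOver {M : X.Modules} {U : X.Opens}
    (P : SheafOfModules.Presentation.{u} (M.restrict U.ι)) :
    (SheafOfModules.over (R := X.ringCatSheaf) M U).Presentation := by
  let e : SheafOfModules.{u} (X.ringCatSheaf.over U) ≌
      SheafOfModules.{u} (U : Scheme.{u}).ringCatSheaf := overEquiv U
  have : PreservesColimitsOfSize.{u, u} e.inverse :=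
    e.symm.toAdjunction.leftAdjoint_preservesColimits
  let η : SheafOfModules.unit.{u} (X.ringCatSheaf.over U) ≅
      e.inverse.obj (SheafOfModules.unit.{u} (U : Scheme.{u}).ringCatSheaf) :=
    e.unitIso.app (SheafOfModules.unit.{u} (X.ringCatSheaf.over U))
  let i : SheafOfModules.over (R := X.ringCatSheaf) M U ≅ e.inverse.obj (M.restrict U.ι) :=
    e.unitIso.app _ ≪≫ e.inverse.mapIso ((overFunctorEquiv U).app M)
  exact SheafOfModules.Presentation.ofIsIso.{u, u, u} i.inv (P.map e.inverse η)

lemma isQuasicoherent_of_isLocalizingOn (M : X.Modules)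
    (h : ∀ x : X, ∃ U : X.Opens, x ∈ U ∧ IsAffineOpen U ∧ M.IsLocalizingOn U) :
    isQuasicoherent X M := by
  choose U hxU hU hM using h
  have pres (x : X) :
      Nonempty (SheafOfModules.over (R := X.ringCatSheaf) M (U x)).Presentation := by
    have : IsLocalizing (modulesSpecToSheaf.obj (M.restrict (hU x).fromSpec)) :=
      (isLocalizing_restrict_fromSpec_iff M (hU x)).2 (hM x)
    have : IsIso (M.restrict (hU x).fromSpec).fromTildeΓ :=
      (isIso_fromTildeΓ_iff_isLocalizing _).2 this
    let P := presentationTilde.{u}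
      ((modulesSpecToSheaf.obj (M.restrict (hU x).fromSpec)).presheaf.obj (.op ⊤))
      .univ (by simp) _ (Submodule.span_eq _)
    let P' := presentationRestrict (hU x).isoSpec.hom
      (presentationOfIso (asIso (M.restrict (hU x).fromSpec).fromTildeΓ) P)
    let i : restrictFunctor (hU x).fromSpec ⋙ restrictFunctor (hU x).isoSpec.hom ≅
        restrictFunctor (U x).ι :=
      (restrictFunctorComp _ _).symm ≪≫ restrictFunctorCongr (hU x).isoSpec_hom_fromSpec
    exact ⟨presentationOver (presentationOfIso (i.app M) P')⟩
  refine SheafOfModules.QuasicoherentData.isQuasicoherent (R := X.ringCatSheaf)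
    { I := X
      X := U
      coversTop := ?_
      presentation x := (pres x).some }
  rw [Opens.coversTop_iff, TopologicalSpace.IsOpenCover]
  exact top_le_iff.mp fun x _ ↦ TopologicalSpace.Opens.mem_iSup.2 ⟨x, hxU x⟩

/-! ### Quasicoherent sheaves form an exact abelian subcategory -/

/-- The functor of sections over `U`, with values in abelian groups. -/
noncomputable def sectionsFunctor (U : X.Opens) : X.Modules ⥤ Ab.{u} :=
  toPresheaf X ⋙ (CategoryTheory.evaluation _ _).obj (op U)

instance (U : X.Opens) : (sectionsFunctor U).PreservesZeroMorphisms where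
  map_zero _ _ := rfl

instance (U : X.Opens) : PreservesFiniteLimits (sectionsFunctor U) :=
  have : PreservesFiniteLimits ((CategoryTheory.evaluation (TopologicalSpace.Opens X)ᵒᵖ
      Ab.{u}).obj (op U)) := ⟨fun _ _ _ ↦ inferInstance⟩
  comp_preservesFiniteLimits _ _

@[simp]
lemma app_map {M N : X.Modules} (φ : M ⟶ N) {U V : X.Opens} (i : V ⟶ U) (s : Γ(M, U)) :
    φ.app V (M.presheaf.map i.op s) = N.presheaf.map i.op (φ.app U s) :=
  NatTrans.naturality_apply φ.mapPresheaf i.op s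

lemma app_injective {M N : X.Modules} (φ : M ⟶ N) [Mono φ] (U : X.Opens) :
    Function.Injective (φ.app U) :=
  (AddCommGrpCat.mono_iff_injective ((sectionsFunctor U).map φ)).1 inferInstance

lemma exists_app_eq_of_isLimit {M N : X.Modules} {φ : M ⟶ N} {k : KernelFork φ}
    (hk : IsLimit k) {U : X.Opens} (s : Γ(M, U)) (hs : φ.app U s = 0) :
    ∃ t, k.ι.app U t = s := by
  have h := KernelFork.mapIsLimit k hk (sectionsFunctor U)
  let S : ShortComplex Ab.{u} := ShortComplex.mk _ _ (k.map (sectionsFunctor U)).condition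
  have hS : S.Exact := S.exact_of_f_is_kernel (h.ofIsoLimit (Fork.ext (Iso.refl _)))
  exact (ShortComplex.ab_exact_iff S).1 hS s hs

lemma IsLocalizingOn.of_isLimit_kernelFork {M N : X.Modules} {φ : M ⟶ N} {k : KernelFork φ}
    (hk : IsLimit k) {U : X.Opens} (hM : M.IsLocalizingOn U) (hN : N.IsLocalizingOn U) :
    IsLocalizingOn k.pt U := by
  have : Mono k.ι := mono_of_isLimit_fork hk
  have hk0 (V : X.Opens) (t) : φ.app V (k.ι.app V t) = 0 := by
    rw [← ConcreteCategory.comp_apply, ← Hom.comp_app, k.condition]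
    rfl
  refine ⟨fun f s ↦ ?_, fun f t ht ↦ ?_⟩
  · obtain ⟨n, t, ht⟩ := hM.exists_res_eq f (k.ι.app _ s)
    obtain ⟨m, hm⟩ := hN.exists_pow_smul_eq_zero f (φ.app U t) (by
      rw [← app_map, ht, Hom.app_smul, hk0, smul_zero])
    obtain ⟨t', ht'⟩ := exists_app_eq_of_isLimit hk (f ^ m • t) (by rw [Hom.app_smul, hm])
    refine ⟨m + n, t', app_injective k.ι _ ?_⟩
    rw [app_map, ht', map_smul, ht, Hom.app_smul, pow_add, map_mul, mul_smul]
  · obtain ⟨n, hn⟩ := hM.exists_pow_smul_eq_zero f (k.ι.app U t) (by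
      rw [← app_map, ht, map_zero])
    exact ⟨n, app_injective k.ι _ (by rw [Hom.app_smul, hn, map_zero])⟩

lemma exists_isAffineOpen (x : X) : ∃ U : X.Opens, x ∈ U ∧ IsAffineOpen U := by
  obtain ⟨U, hU, hxU, -⟩ := TopologicalSpace.Opens.isBasis_iff_nbhd.mp X.isBasis_affineOpens
    (show x ∈ (⊤ : X.Opens) from trivial)
  exact ⟨U, hxU, hU⟩

lemma isQuasicoherent_iff_isLocalizingOn (M : X.Modules) :
    isQuasicoherent X M ↔ ∀ U : X.Opens, IsAffineOpen U → M.IsLocalizingOn U := by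
  refine ⟨fun h U hU ↦ .of_isQuasicoherent h hU, fun h ↦ isQuasicoherent_of_isLocalizingOn M ?_⟩
  intro x
  obtain ⟨U, hxU, hU⟩ := exists_isAffineOpen x
  exact ⟨U, hxU, hU, h U hU⟩

instance : (isQuasicoherent X).IsClosedUnderIsomorphisms :=
  inferInstanceAs (SheafOfModules.isQuasicoherent X.ringCatSheaf).IsClosedUnderIsomorphisms

instance : (isQuasicoherent X).IsClosedUnderKernels where
  kernels_le := by
    rintro _ ⟨φ, k, hk, hM, hN⟩
    rw [isQuasicoherent_iff_isLocalizingOn] at hM hN ⊢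
    exact fun U hU ↦ .of_isLimit_kernelFork hk (hM U hU) (hN U hU)

lemma isQuasicoherent_spec_iff {R : CommRingCat.{u}} (M : (Spec R).Modules) :
    isQuasicoherent _ M ↔ (tilde.functor R).essImage M := by
  rw [essImage_tilde]

/-- On an affine scheme the quasicoherent sheaves are those associated with modules, and the functor
which sends a module to the associated sheaf is full and preserves cokernels. -/
lemma isQuasicoherent_of_isColimit_cokernelCofork_of_Spec {R : CommRingCat.{u}}
    {M N : (Spec R).Modules} {φ : M ⟶ N} {c : CokernelCofork φ} (hc : IsColimit c)
    (hM : isQuasicoherent _ M) (hN : isQuasicoherent _ N) : isQuasicoherent _ c.pt := by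
  rw [isQuasicoherent_spec_iff] at hM hN ⊢
  obtain ⟨A, ⟨a⟩⟩ := hM
  obtain ⟨B, ⟨b⟩⟩ := hN
  let ψ := (tilde.functor R).preimage (a.hom ≫ φ ≫ b.inv)
  have hψ : (tilde.functor R).map ψ = a.hom ≫ φ ≫ b.inv := (tilde.functor R).map_preimage _
  exact ⟨cokernel ψ, ⟨PreservesCokernel.iso (tilde.functor R) ψ ≪≫
    cokernel.mapIso _ φ a b (by rw [hψ]; simp) ≪≫
    IsColimit.coconePointUniqueUpToIso (colimit.isColimit _) hc⟩⟩

instance : (isQuasicoherent X).IsClosedUnderCokernels where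
  cokernels_le := by
    rintro _ ⟨φ, c, hc, hM, hN⟩
    rw [isQuasicoherent_iff_isLocalizingOn] at hM hN ⊢
    intro U hU
    have := Functor.preservesZeroMorphisms_of_isLeftAdjoint (restrictFunctor hU.fromSpec)
    rw [← isQuasicoherent_restrict_fromSpec_iff _ hU]
    exact isQuasicoherent_of_isColimit_cokernelCofork_of_Spec
      (CokernelCofork.mapIsColimit c hc (restrictFunctor hU.fromSpec))
      ((isQuasicoherent_restrict_fromSpec_iff _ hU).2 (hM U hU))
      ((isQuasicoherent_restrict_fromSpec_iff _ hU).2 (hN U hU))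

instance : (isQuasicoherent X).ContainsZero where
  exists_zero := by
    obtain ⟨Z, hZ⟩ := HasZeroObject.zero (C := X.Modules)
    refine ⟨Z, hZ, ?_⟩
    rw [isQuasicoherent_iff_isLocalizingOn]
    have h (U : X.Opens) (s : Γ(Z, U)) : s = 0 :=
      congr(($(hZ.eq_of_src (𝟙 Z) 0)).app U s)
    exact fun U hU ↦ ⟨fun f s ↦ ⟨0, 0, by rw [h _ s, smul_zero, map_zero]⟩,
      fun f t _ ↦ ⟨0, by rw [h _ t, smul_zero]⟩⟩

lemma IsLocalizingOn.biprod {M N : X.Modules} {U : X.Opens} (hM : M.IsLocalizingOn U)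
    (hN : N.IsLocalizingOn U) : IsLocalizingOn (M ⊞ N) U := by
  have h0 {P Q R : X.Modules} (a : P ⟶ Q) (b : Q ⟶ R) (V : X.Opens) (s : Γ(P, V)) :
      b.app V (a.app V s) = (a ≫ b).app V s := rfl
  have ext {V : X.Opens} {s t : Γ(M ⊞ N, V)}
      (h₁ : (biprod.fst : M ⊞ N ⟶ M).app V s = (biprod.fst : M ⊞ N ⟶ M).app V t)
      (h₂ : (biprod.snd : M ⊞ N ⟶ N).app V s = (biprod.snd : M ⊞ N ⟶ N).app V t) : s = t := by
    have H (s : Γ(M ⊞ N, V)) : (biprod.inl : M ⟶ M ⊞ N).app V ((biprod.fst : M ⊞ N ⟶ M).app V s) +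
        (biprod.inr : N ⟶ M ⊞ N).app V ((biprod.snd : M ⊞ N ⟶ N).app V s) = s :=
      congr(($(biprod.total (X := M) (Y := N))).app V s)
    rw [← H s, ← H t, h₁, h₂]
  refine ⟨fun f s ↦ ?_, fun f t ht ↦ ?_⟩
  · obtain ⟨n, a, ha⟩ := hM.exists_res_eq f ((biprod.fst : M ⊞ N ⟶ M).app _ s)
    obtain ⟨m, b, hb⟩ := hN.exists_res_eq f ((biprod.snd : M ⊞ N ⟶ N).app _ s)
    refine ⟨n + m, (biprod.inl : M ⟶ M ⊞ N).app U (f ^ m • a) +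
      (biprod.inr : N ⟶ M ⊞ N).app U (f ^ n • b), ext ?_ ?_⟩
    · rw [app_map, map_add, h0, h0, biprod.inl_fst, biprod.inr_fst, Hom.app_smul, Hom.app_smul,
        Hom.app_smul, add_comm n, pow_add, map_mul, mul_smul, ← ha]
      simp
    · rw [app_map, map_add, h0, h0, biprod.inl_snd, biprod.inr_snd, Hom.app_smul, Hom.app_smul,
        Hom.app_smul, pow_add, map_mul, mul_smul, ← hb]
      simp
  · obtain ⟨n, hn⟩ := hM.exists_pow_smul_eq_zero f ((biprod.fst : M ⊞ N ⟶ M).app _ t)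
      (by rw [← app_map, ht, map_zero])
    obtain ⟨m, hm⟩ := hN.exists_pow_smul_eq_zero f ((biprod.snd : M ⊞ N ⟶ N).app _ t)
      (by rw [← app_map, ht, map_zero])
    refine ⟨n + m, ext ?_ ?_⟩
    · rw [Hom.app_smul, add_comm, pow_add, mul_smul, hn, smul_zero, map_zero]
    · rw [Hom.app_smul, pow_add, mul_smul, hm, smul_zero, map_zero]

instance : (isQuasicoherent X).IsClosedUnderBinaryProducts where
  limitsOfShape_le := by
    rintro M ⟨p⟩
    have h₁ := p.prop_diag_obj (.mk .left)
    have h₂ := p.prop_diag_obj (.mk .right)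
    refine (isQuasicoherent X).prop_of_iso
      (IsLimit.conePointUniqueUpToIso (BinaryBiproduct.isLimit _ _)
        ((IsLimit.postcomposeHomEquiv (diagramIsoPair p.diag) _).2 p.isLimit)) ?_
    rw [isQuasicoherent_iff_isLocalizingOn] at h₁ h₂ ⊢
    exact fun U hU ↦ (h₁ U hU).biprod (h₂ U hU)

instance : (isQuasicoherent X).IsClosedUnderFiniteProducts := .mk'

end AlgebraicGeometry.Scheme.Modules

namespace AlgebraicGeometry.Scheme.QCoh

variable {X : Scheme.{u}}

noncomputable instance : Abelian X.QCoh :=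
  inferInstanceAs (Abelian (isQuasicoherent X).FullSubcategory)

/-- The inclusion of the quasicoherent sheaves is exact: kernels and cokernels of morphisms between
quasicoherent sheaves, taken among all sheaves of modules, are quasicoherent. -/
lemma shortExact_map_ι {S : ShortComplex X.QCoh} (hS : S.ShortExact) :
    (S.map (isQuasicoherent X).ι).ShortExact := by
  have := (isQuasicoherent X).preservesMonomorphisms_ι_of_isNormalEpiCategory
  have : (isQuasicoherent X).ι.PreservesHomology :=
    { preservesKernels _ _ f := (isQuasicoherent X).preservesKernels_ι f
      preservesCokernels _ _ f := (isQuasicoherent X).preservesCokernels_ι f }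
  have := (isQuasicoherent X).preservesEpimorphisms_ι_of_isNormalMonoCategory
  have := hS.mono_f
  have := hS.epi_g
  exact hS.map _

end AlgebraicGeometry.Scheme.QCoh

/-! ### The sheaf of homomorphisms -/

namespace AlgebraicGeometry.Scheme.Modules

variable {X : Scheme.{u}}

lemma map_map (M : X.Modules) {U V W : X.Opens} (i : V ⟶ U) (j : W ⟶ V) (k : W ⟶ U)
    (s : Γ(M, U)) : M.presheaf.map j.op (M.presheaf.map i.op s) = M.presheaf.map k.op s := by
  obtain rfl : k = j ≫ i := Subsingleton.elim _ _
  rw [op_comp, Functor.map_comp, ConcreteCategory.comp_apply]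

lemma eq_of_cover (M : X.Modules) {W : X.Opens} {ι : Type u} {U : ι → X.Opens} (hW : W ≤ iSup U)
    {s t : Γ(M, W)} (h : ∀ i, M.presheaf.map (homOfLE (inf_le_left : W ⊓ U i ≤ W)).op s =
      M.presheaf.map (homOfLE (inf_le_left : W ⊓ U i ≤ W)).op t) : s = t :=
  TopCat.Sheaf.eq_of_locally_eq' ⟨_, M.isSheaf⟩ (fun i ↦ W ⊓ U i) W _
    (by rw [← inf_iSup_eq]; exact le_inf le_rfl hW) s t h

/-- A morphism `A|_U ⟶ E|_U` of sheaves of modules, encoded as a compatible family of linear maps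
`Γ(A, V) → Γ(E, V)` for the open subsets `V ≤ U`. -/
@[ext]
structure LocalHom (A E : X.Modules) (U : X.Opens) where
  /-- the map on sections over `V ≤ U` -/
  app (V : X.Opens) (hV : V ≤ U) : Γ(A, V) →ₗ[Γ(X, V)] Γ(E, V)
  app_map {V W : X.Opens} (hV : V ≤ U) (i : W ⟶ V) (a : Γ(A, V)) :
    app W (i.le.trans hV) (A.presheaf.map i.op a) = E.presheaf.map i.op (app V hV a)

namespace LocalHom

variable {A B E : X.Modules} {U V W : X.Opens}

lemma ext_apply {φ ψ : LocalHom A E U} (h : ∀ V hV a, φ.app V hV a = ψ.app V hV a) : φ = ψ :=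
  LocalHom.ext (funext fun V ↦ funext fun hV ↦ LinearMap.ext (h V hV))

noncomputable instance : Zero (LocalHom A E U) where
  zero := { app _ _ := 0, app_map _ _ _ := by simp }

noncomputable instance : Add (LocalHom A E U) where
  add φ ψ :=
    { app V hV := φ.app V hV + ψ.app V hV
      app_map hV i a := by simp [φ.app_map hV i a, ψ.app_map hV i a] }

noncomputable instance : Neg (LocalHom A E U) where
  neg φ :=
    { app V hV := - φ.app V hV
      app_map hV i a := by simp [φ.app_map hV i a] }

noncomputable instance : SMul Γ(X, U) (LocalHom A E U) where
  smul r φ :=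
    { app V hV := X.presheaf.map (homOfLE hV).op r • φ.app V hV
      app_map {V W} hV i a := by
        have : X.presheaf.map (homOfLE (i.le.trans hV)).op r =
            X.presheaf.map i.op (X.presheaf.map (homOfLE hV).op r) := by
          rw [← ConcreteCategory.comp_apply, ← Functor.map_comp]; rfl
        rw [LinearMap.smul_apply, LinearMap.smul_apply, map_smul, app_map, this] }

@[simp] lemma zero_app (hV : V ≤ U) : (0 : LocalHom A E U).app V hV = 0 := rfl

@[simp] lemma add_app (φ ψ : LocalHom A E U) (hV : V ≤ U) :
    (φ + ψ).app V hV = φ.app V hV + ψ.app V hV := rfl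

@[simp] lemma neg_app (φ : LocalHom A E U) (hV : V ≤ U) :
    (-φ).app V hV = - φ.app V hV := rfl

@[simp] lemma smul_app (r : Γ(X, U)) (φ : LocalHom A E U) (hV : V ≤ U) :
    (r • φ).app V hV = X.presheaf.map (homOfLE hV).op r • φ.app V hV := rfl

noncomputable instance : AddCommGroup (LocalHom A E U) where
  add_assoc φ ψ χ := by ext; simp [add_assoc]
  zero_add φ := by ext; simp
  add_zero φ := by ext; simp
  neg_add_cancel φ := by ext; simp
  add_comm φ ψ := by ext; simp [add_comm]
  nsmul := nsmulRec
  zsmul := zsmulRec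

noncomputable instance : Module Γ(X, U) (LocalHom A E U) where
  one_smul φ := by ext; simp
  mul_smul r s φ := by ext; simp [mul_smul]
  smul_zero r := by ext; simp
  smul_add r φ ψ := by ext; simp
  add_smul r s φ := by ext; simp [add_smul]
  zero_smul φ := by ext; simp

/-- The restriction of a morphism `A|_U ⟶ E|_U` to an open subset `V ≤ U`. -/
@[simps]
noncomputable def restrict (h : V ≤ U) : LocalHom A E U →+ LocalHom A E V where
  toFun φ := { app W hW := φ.app W (hW.trans h), app_map _ _ _ := φ.app_map _ _ _ }
  map_zero' := rfl
  map_add' _ _ := rfl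

lemma restrict_smul (i : V ⟶ U) (r : Γ(X, U)) (φ : LocalHom A E U) :
    restrict i.le (r • φ) = X.presheaf.map i.op r • restrict i.le φ := by
  refine ext_apply fun W hW a ↦ ?_
  have : X.presheaf.map (homOfLE (hW.trans i.le)).op r =
      X.presheaf.map (homOfLE hW).op (X.presheaf.map i.op r) := by
    rw [← ConcreteCategory.comp_apply, ← Functor.map_comp]; rfl
  exact congr($this • φ.app W (hW.trans i.le) a)

variable (A E) in
/-- The presheaf `U ↦ Hom(A|_U, E|_U)` of abelian groups. -/
@[simps]
noncomputable def abPresheaf : (TopologicalSpace.Opens X)ᵒᵖ ⥤ Ab.{u} where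
  obj U := AddCommGrpCat.of (LocalHom A E U.unop)
  map i := AddCommGrpCat.ofHom (restrict i.unop.le)
  map_id _ := rfl
  map_comp _ _ := rfl

lemma isSheaf_abPresheaf : TopCat.Presheaf.IsSheaf (X := X.toTopCat) (abPresheaf A E) := by
  rw [TopCat.Presheaf.isSheaf_iff_isSheafUniqueGluing]
  intro ι U sf hsf
  change ∀ i, LocalHom A E (U i) at sf
  have hsf' {i j : ι} {V : X.Opens} (hi : V ≤ U i) (hj : V ≤ U j) (a : Γ(A, V)) :
      (sf i).app V hi a = (sf j).app V hj a :=
    congr(($(hsf i j) : LocalHom A E (U i ⊓ U j)).app V (le_inf hi hj) a)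
  -- The glued morphism sends `a` to the gluing of the images of its restrictions to `W ⊓ U i`.
  have hW {W : X.Opens} (hW : W ≤ iSup U) (a : Γ(A, W)) : ∃ e : Γ(E, W), ∀ i,
      E.presheaf.map (homOfLE (inf_le_left : W ⊓ U i ≤ W)).op e =
        (sf i).app (W ⊓ U i) inf_le_right
          (A.presheaf.map (homOfLE (inf_le_left : W ⊓ U i ≤ W)).op a) := by
    obtain ⟨e, he, -⟩ := TopCat.Sheaf.existsUnique_gluing' ⟨_, E.isSheaf⟩ (fun i ↦ W ⊓ U i) W
      (fun i ↦ homOfLE inf_le_left) (by rw [← inf_iSup_eq]; exact le_inf le_rfl hW)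
      (fun i ↦ (sf i).app (W ⊓ U i) inf_le_right
          (A.presheaf.map (homOfLE (inf_le_left : W ⊓ U i ≤ W)).op a)) (fun i j ↦ by
        dsimp only
        erw [← app_map, ← app_map]
        rw [map_map A _ _ (homOfLE (inf_le_left.trans inf_le_left)),
          map_map A _ _ (homOfLE (inf_le_left.trans inf_le_left))]
        apply hsf')
    exact ⟨e, he⟩
  choose e he using @hW
  have he' {W : X.Opens} (hW : W ≤ iSup U) (a : Γ(A, W)) (i : ι) (hi : W ≤ U i) :
      e hW a = (sf i).app W hi a := by
    refine eq_of_cover E hW fun j ↦ ?_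
    rw [he, ← app_map]
    apply hsf'
  have he_eq {W : X.Opens} (hW : W ≤ iSup U) (a : Γ(A, W)) (x : Γ(E, W))
      (h : ∀ i, E.presheaf.map (homOfLE (inf_le_left : W ⊓ U i ≤ W)).op x =
        (sf i).app (W ⊓ U i) inf_le_right
          (A.presheaf.map (homOfLE (inf_le_left : W ⊓ U i ≤ W)).op a)) : e hW a = x :=
    eq_of_cover E hW fun j ↦ by rw [he, h]
  refine ⟨(⟨fun W hW ↦
    { toFun := e hW
      map_add' a b := he_eq _ _ _ fun i ↦ by rw [map_add, he, he, map_add, map_add]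
      map_smul' r a := he_eq _ _ _ fun i ↦ by
        rw [RingHom.id_apply, map_smul, he, map_smul, LinearMap.map_smul] },
    fun {V W} hV i a ↦ ?_⟩ : LocalHom A E (iSup U)), fun i ↦ ?_, fun ψ hψ ↦ ?_⟩
  · refine he_eq _ _ _ fun j ↦ ?_
    change E.presheaf.map _ (E.presheaf.map i.op (e hV a)) = _
    rw [map_map E i _ (homOfLE (inf_le_left.trans i.le)),
      map_map A i _ (homOfLE (inf_le_left.trans i.le)),
      ← map_map E (homOfLE (inf_le_left : V ⊓ U j ≤ V)) (homOfLE (inf_le_inf_right _ i.le)),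
      he, ← app_map, map_map A _ _ (homOfLE (inf_le_left.trans i.le))]
  · exact ext_apply fun V hV a ↦ he' _ a i hV
  · refine ext_apply fun V hV a ↦ (he_eq hV a _ fun i ↦ ?_).symm
    rw [← hψ i]
    exact (app_map (show LocalHom A E (iSup U) from ψ) hV (homOfLE inf_le_left) a).symm

end LocalHom

/-- The sheaf of homomorphisms `U ↦ Hom(A|_U, E|_U)`. It is defined for all sheaves of modules, and
is the internal hom of the category of all sheaves of modules. -/
noncomputable def sheafHom (A E : X.Modules) : X.Modules where
  val :=
    letI (U : (TopologicalSpace.Opens X)ᵒᵖ) : Module (X.ringCatSheaf.obj.obj U)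
      ((LocalHom.abPresheaf A E).obj U) :=
      inferInstanceAs (Module Γ(X, U.unop) (LocalHom A E U.unop))
    PresheafOfModules.ofPresheaf (LocalHom.abPresheaf A E) fun U V i r φ ↦
      LocalHom.restrict_smul (U := U.unop) (V := V.unop) i.unop r φ
  isSheaf := LocalHom.isSheaf_abPresheaf

variable {A E T : X.Modules}

/-- The sections of `sheafHom A E` over `U` are the morphisms `A|_U ⟶ E|_U`. -/
noncomputable def toLocalHom {U : X.Opens} : Γ(sheafHom A E, U) ≃+ LocalHom A E U :=
  AddEquiv.refl _

@[simp] lemma toLocalHom_map {U V : X.Opens} (i : V ⟶ U) (φ : Γ(sheafHom A E, U)) :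
    toLocalHom ((sheafHom A E).presheaf.map i.op φ) = (toLocalHom φ).restrict i.le := rfl

@[simp] lemma toLocalHom_smul {U : X.Opens} (r : Γ(X, U)) (φ : Γ(sheafHom A E, U)) :
    toLocalHom (r • φ) = r • toLocalHom φ := rfl

/-- Constructor for morphisms of sheaves of modules from a compatible family of linear maps. -/
noncomputable def homMk {M N : X.Modules} (f : ∀ U : X.Opens, Γ(M, U) →ₗ[Γ(X, U)] Γ(N, U))
    (hf : ∀ {U V : X.Opens} (i : V ⟶ U) (s : Γ(M, U)),
      f V (M.presheaf.map i.op s) = N.presheaf.map i.op (f U s)) : M ⟶ N where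
  val :=
    { app U := ModuleCat.ofHom (f U.unop)
      naturality i := by ext s; exact hf i.unop s }

@[simp] lemma homMk_app {M N : X.Modules} (f : ∀ U : X.Opens, Γ(M, U) →ₗ[Γ(X, U)] Γ(N, U))
    (hf) (U : X.Opens) (s : Γ(M, U)) : (homMk f hf).app U s = f U s := rfl

/-! ### Bilinear pairings and the tensor-hom adjunction -/

/-- The map on sections over `U` of a morphism of sheaves of modules, as a linear map. -/
noncomputable def Hom.appₗ {M N : X.Modules} (f : M ⟶ N) (U : X.Opens) :
    Γ(M, U) →ₗ[Γ(X, U)] Γ(N, U) where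
  toFun := f.app U
  map_add' := map_add _
  map_smul' := Hom.app_smul f

/-- A bilinear pairing `T × A → E` of sheaves of modules: a compatible family of bilinear maps on
sections. Both morphisms `T ⊗ A ⟶ E` and morphisms `T ⟶ Hom(A, E)` correspond to such pairings,
and pairings are symmetric in `T` and `A`. -/
@[ext]
structure Bilin (T A E : X.Modules) where
  /-- the bilinear map on sections over `U` -/
  app (U : X.Opens) : Γ(T, U) →ₗ[Γ(X, U)] Γ(A, U) →ₗ[Γ(X, U)] Γ(E, U)
  app_map {U V : X.Opens} (i : V ⟶ U) (t : Γ(T, U)) (a : Γ(A, U)) :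
    app V (T.presheaf.map i.op t) (A.presheaf.map i.op a) = E.presheaf.map i.op (app U t a)

namespace Bilin

variable {T T' A A' E : X.Modules}

lemma ext_apply {b c : Bilin T A E} (h : ∀ U s a, b.app U s a = c.app U s a) : b = c :=
  Bilin.ext (funext fun U ↦ LinearMap.ext₂ (h U))

/-- The same pairing with the two arguments exchanged. -/
@[simps]
noncomputable def flip (b : Bilin T A E) : Bilin A T E where
  app U := (b.app U).flip
  app_map i a t := b.app_map i t a

/-- Precomposition of a pairing with morphisms in both arguments. -/
noncomputable def comp (b : Bilin T A E) (f : T' ⟶ T) (g : A' ⟶ A) : Bilin T' A' E where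
  app U := (b.app U).compl₁₂ (Hom.appₗ f U) (Hom.appₗ g U)
  app_map i t a := by
    simp [Hom.appₗ, b.app_map]

@[simp] lemma comp_app (b : Bilin T A E) (f : T' ⟶ T) (g : A' ⟶ A) (U : X.Opens) (t a) :
    (b.comp f g).app U t a = b.app U (f.app U t) (g.app U a) := rfl

/-- Pairings `T × A → E` correspond to morphisms from `T` to the sheaf of homomorphisms from `A` to
`E`. -/
noncomputable def curry : Bilin T A E ≃ (T ⟶ sheafHom A E) where
  toFun b := homMk (fun U ↦
    { toFun t := toLocalHom.symm
        { app V hV := b.app V (T.presheaf.map (homOfLE hV).op t)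
          app_map {V W} hV i a := by
            rw [← b.app_map, map_map T _ _ (homOfLE (i.le.trans hV))] }
      map_add' s t := LocalHom.ext_apply fun V hV a ↦ by
        change b.app V (T.presheaf.map (homOfLE hV).op (s + t)) a =
          b.app V (T.presheaf.map (homOfLE hV).op s) a +
            b.app V (T.presheaf.map (homOfLE hV).op t) a
        simp
      map_smul' r t := LocalHom.ext_apply fun V hV a ↦ by
        change b.app V (T.presheaf.map (homOfLE hV).op (r • t)) a =
          X.presheaf.map (homOfLE hV).op r • b.app V (T.presheaf.map (homOfLE hV).op t) a
        simp })
    fun {U V} i t ↦ LocalHom.ext_apply fun W hW a ↦ by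
      change b.app W (T.presheaf.map (homOfLE hW).op (T.presheaf.map i.op t)) a =
        b.app W (T.presheaf.map (homOfLE (hW.trans i.le)).op t) a
      rw [map_map T _ _ (homOfLE (hW.trans i.le))]
  invFun θ :=
    { app U := LinearMap.mk₂ _ (fun t a ↦ (toLocalHom (θ.app U t)).app U le_rfl a)
        (fun s t a ↦ by simp) (fun r t a ↦ by simp [Hom.app_smul])
        (fun s t a ↦ by simp) (fun r t a ↦ by simp)
      app_map i t a := by
        simp only [LinearMap.mk₂_apply, Modules.app_map, toLocalHom_map]
        exact (toLocalHom (θ.app _ t)).app_map le_rfl i a }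
  left_inv b := ext_apply fun U t a ↦ by
    change b.app U (T.presheaf.map (homOfLE le_rfl).op t) a = _
    rw [show homOfLE le_rfl = 𝟙 U from rfl]
    simp
  right_inv θ := by
    ext U t
    refine LocalHom.ext_apply fun V hV a ↦ ?_
    change (toLocalHom (θ.app V (T.presheaf.map (homOfLE hV).op t))).app V le_rfl a =
      (toLocalHom (θ.app U t)).app V hV a
    simp

lemma curry_app (b : Bilin T A E) {U V : X.Opens} (hV : V ≤ U) (t : Γ(T, U)) (a : Γ(A, V)) :
    (toLocalHom (b.curry.app U t)).app V hV a = b.app V (T.presheaf.map (homOfLE hV).op t) a :=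
  rfl

lemma curry_symm_app (θ : T ⟶ sheafHom A E) (U : X.Opens) (t : Γ(T, U)) (a : Γ(A, U)) :
    (curry.symm θ).app U t a = (toLocalHom (θ.app U t)).app U le_rfl a :=
  rfl

lemma curry_symm_comp (f : T' ⟶ T) (θ : T ⟶ sheafHom A E) :
    curry.symm (f ≫ θ) = (curry.symm θ).comp f (𝟙 A) := rfl

lemma curry_comp (b : Bilin T A E) (f : T' ⟶ T) : (b.comp f (𝟙 A)).curry = f ≫ b.curry :=
  curry.symm.injective (by simp [curry_symm_comp])

end Bilin

/-- The component on `U` of a morphism of presheaves of modules out of the presheaf tensor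
product, as a linear map. -/
noncomputable def tensorAppₗ {T A : X.Modules} {P : X.Modules} (ψ : presheafTensorObj T A ⟶ P.val)
    (U : X.Opens) : TensorProduct Γ(X, U) Γ(T, U) Γ(A, U) →ₗ[Γ(X, U)] Γ(P, U) :=
  { toFun x := (ψ.app (op U)).hom x
    map_add' x y := (ψ.app (op U)).hom.map_add x y
    map_smul' r x := (ψ.app (op U)).hom.map_smul r x }

lemma tensorAppₗ_map {T A P : X.Modules} (ψ : presheafTensorObj T A ⟶ P.val) {U V : X.Opens}
    (i : V ⟶ U) (t : Γ(T, U)) (a : Γ(A, U)) :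
    tensorAppₗ ψ V (TensorProduct.tmul Γ(X, V) (T.presheaf.map i.op t) (A.presheaf.map i.op a)) =
      P.presheaf.map i.op (tensorAppₗ ψ U (TensorProduct.tmul Γ(X, U) t a)) :=
  PresheafOfModules.naturality_apply ψ i.op (TensorProduct.tmul Γ(X, U) t a)

lemma presheafTensor_hom_ext {T A P : X.Modules}
    {φ ψ : presheafTensorObj T A ⟶ P.val} (h : ∀ (U : X.Opens) (t : Γ(T, U)) (a : Γ(A, U)),
      tensorAppₗ φ U (TensorProduct.tmul Γ(X, U) t a) =
        tensorAppₗ ψ U (TensorProduct.tmul Γ(X, U) t a)) : φ = ψ := by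
  ext1 U
  exact ModuleCat.MonoidalCategory.tensor_ext (fun t a ↦ h U.unop t a)

/-- Constructor for morphisms out of the presheaf tensor product; compatibility with restriction is
only required on pure tensors. -/
noncomputable def tensorHomMk {T A P : X.Modules}
    (f : ∀ U : X.Opens, TensorProduct Γ(X, U) Γ(T, U) Γ(A, U) →ₗ[Γ(X, U)] Γ(P, U))
    (hf : ∀ {U V : X.Opens} (i : V ⟶ U) (t : Γ(T, U)) (a : Γ(A, U)),
      f V (TensorProduct.tmul Γ(X, V) (T.presheaf.map i.op t) (A.presheaf.map i.op a)) =
        P.presheaf.map i.op (f U (TensorProduct.tmul Γ(X, U) t a))) :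
    presheafTensorObj T A ⟶ P.val where
  app U := ConcreteCategory.ofHom (C := ModuleCat (X.ringCatSheaf.obj.obj U))
    (X := (presheafTensorObj T A).obj U) (Y := P.val.obj U)
    { toFun x := f U.unop x
      map_add' x y := (f U.unop).map_add x y
      map_smul' r x := (f U.unop).map_smul r x }
  naturality i := ModuleCat.MonoidalCategory.tensor_ext (fun t a ↦ hf i.unop t a)

/-- Pairings `T × A → E` correspond to morphisms from the presheaf tensor product to `E`. -/
noncomputable def presheafTensorHomEquiv {T A E : X.Modules} :
    (presheafTensorObj T A ⟶ E.val) ≃ Bilin T A E where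
  toFun ψ :=
    { app U := (TensorProduct.mk _ _ _).compr₂ (tensorAppₗ ψ U)
      app_map i t a := tensorAppₗ_map ψ i t a }
  invFun b := tensorHomMk (fun U ↦ TensorProduct.lift (b.app U)) (fun i t a ↦ b.app_map i t a)
  left_inv _ := presheafTensor_hom_ext fun _ _ _ ↦ rfl
  right_inv _ := rfl

/-- Sheafification is left adjoint to the inclusion of sheaves into presheaves of modules. -/
noncomputable def sheafificationAdjunction (X : Scheme.{u}) :
    sheafification X ⊣ toPresheafOfModules X :=
  PresheafOfModules.sheafificationAdjunction (𝟙 X.ringCatSheaf.obj)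

/-- Pairings `T × A → E` correspond to morphisms `T ⊗ A ⟶ E`. -/
noncomputable def tensorHomEquiv {T A E : X.Modules} : (tensorObj T A ⟶ E) ≃ Bilin T A E :=
  ((sheafificationAdjunction X).homEquiv _ E).trans presheafTensorHomEquiv

lemma tensorHomEquiv_comp {T T' A A' E : X.Modules} (f : T' ⟶ T) (g : A' ⟶ A)
    (ψ : tensorObj T A ⟶ E) :
    tensorHomEquiv (tensorMap f g ≫ ψ) = (tensorHomEquiv ψ).comp f g := by
  have := (sheafificationAdjunction X).homEquiv_naturality_left (presheafTensorMap f g) ψ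
  exact congr(presheafTensorHomEquiv $this)

lemma tensorMap_comp_left {M M' M'' N : X.Modules} (f : M ⟶ M') (f' : M' ⟶ M'') :
    tensorMap (f ≫ f') (𝟙 N) = tensorMap f (𝟙 N) ≫ tensorMap f' (𝟙 N) := by
  rw [← tensorMap_comp, Category.comp_id]

/-- The morphism from the sheaf of homomorphisms out of `B` to the one out of `A` given by
precomposition with `f : A ⟶ B`. -/
noncomputable def sheafHomMap {A B : X.Modules} (f : A ⟶ B) (E : X.Modules) :
    sheafHom B E ⟶ sheafHom A E :=
  Bilin.curry ((Bilin.curry.symm (𝟙 (sheafHom B E))).comp (𝟙 _) f)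

lemma toLocalHom_sheafHomMap {A B E : X.Modules} (f : A ⟶ B) {U V : X.Opens} (hV : V ≤ U)
    (φ : Γ(sheafHom B E, U)) (a : Γ(A, V)) :
    (toLocalHom ((sheafHomMap f E).app U φ)).app V hV a =
      (toLocalHom φ).app V hV (f.app V a) := by
  rw [sheafHomMap, Bilin.curry_app, Bilin.comp_app, Bilin.curry_symm_app]
  simp

end AlgebraicGeometry.Scheme.Modules

namespace AlgebraicGeometry.Scheme.QCoh

open Modules

variable {X : Scheme.{u}}

/-- If the sheaf of homomorphisms from `A` to `E` is quasicoherent, then it is an internal hom in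
the category of quasicoherent sheaves. -/
noncomputable def internalHomOfSheafHom {A E : X.QCoh}
    (h : isQuasicoherent X (sheafHom A.obj E.obj)) : InternalHom A E where
  obj := ⟨_, h⟩
  adj :=
    { homEquiv {T} := show (T ⟶ ⟨_, h⟩) ≃ (tensorObj T.obj A.obj ⟶ E.obj) from
        { toFun t := tensorHomEquiv.symm (Bilin.curry.symm t.hom)
          invFun ψ := ObjectProperty.homMk (tensorHomEquiv ψ).curry
          left_inv _ := by simp; rfl
          right_inv _ := by simp }
      homEquiv_comp {T T'} f g := by
        change tensorHomEquiv.symm (Bilin.curry.symm (f.hom ≫ g.hom)) =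
          tensorMap f.hom (𝟙 A.obj) ≫ tensorHomEquiv.symm (Bilin.curry.symm g.hom)
        apply tensorHomEquiv.injective
        rw [tensorHomEquiv_comp, Equiv.apply_symm_apply, Equiv.apply_symm_apply,
          Bilin.curry_symm_comp] }

namespace InternalHom

variable {A B C E : X.QCoh}

/-- The pairing `T × A → E` corresponding to a morphism `T ⟶ Hom^qc(A, E)`. -/
noncomputable def pairing (H : InternalHom A E) {T : X.QCoh} :
    (T ⟶ H.obj) ≃ Bilin T.obj A.obj E.obj :=
  Equiv.trans (β := tensorObj T.obj A.obj ⟶ E.obj) H.adj.homEquiv tensorHomEquiv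

lemma pairing_apply (H : InternalHom A E) {T : X.QCoh} (t : T ⟶ H.obj) :
    H.pairing t = tensorHomEquiv (tensorMap t.hom (𝟙 A.obj) ≫ H.ev) :=
  congr(tensorHomEquiv $(H.homEquiv_eq t))

lemma pairing_comp (H : InternalHom A E) {T T' : X.QCoh} (f : T' ⟶ T) (t : T ⟶ H.obj) :
    H.pairing (f ≫ t) = (H.pairing t).comp f.hom (𝟙 _) := by
  rw [pairing_apply, pairing_apply, ← tensorHomEquiv_comp, ← Category.assoc,
    ← tensorMap_comp_left]
  rfl

lemma pairing_comp_map (f : A ⟶ B) (HB : InternalHom B E) (HA : InternalHom A E) {T : X.QCoh}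
    (t : T ⟶ HB.obj) : HA.pairing (t ≫ map f HB HA) = (HB.pairing t).comp (𝟙 _) f.hom := by
  rw [pairing_comp, pairing_apply, pairing_apply, map_ev, ← tensorHomEquiv_comp,
    ← tensorHomEquiv_comp, ← Category.assoc, ← Category.assoc, ← tensorMap_comp,
    ← tensorMap_comp]
  simp

/-- The comparison morphism from the sheaf of homomorphisms, if that is quasicoherent, to an
arbitrary internal hom. -/
noncomputable def fromSheafHom (h : isQuasicoherent X (sheafHom A.obj E.obj))
    (H : InternalHom A E) : (⟨_, h⟩ : X.QCoh) ⟶ H.obj :=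
  H.pairing.symm (Bilin.curry.symm (𝟙 _))

instance (h : isQuasicoherent X (sheafHom A.obj E.obj)) (H : InternalHom A E) :
    IsSplitEpi (fromSheafHom h H) :=
  ⟨⟨{ section_ := ObjectProperty.homMk (H.pairing (𝟙 _)).curry
      id := by
        apply H.pairing.injective
        rw [pairing_comp, fromSheafHom, Equiv.apply_symm_apply, ← Bilin.curry_symm_comp]
        simp }⟩⟩

lemma fromSheafHom_comp_map (f : A ⟶ B) (hA : isQuasicoherent X (sheafHom A.obj E.obj))
    (hB : isQuasicoherent X (sheafHom B.obj E.obj)) (HB : InternalHom B E) (HA : InternalHom A E) :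
    fromSheafHom hB HB ≫ map f HB HA = ObjectProperty.homMk (sheafHomMap f.hom E.obj) ≫
      fromSheafHom hA HA := by
  apply HA.pairing.injective
  rw [pairing_comp_map, pairing_comp, fromSheafHom, fromSheafHom, Equiv.apply_symm_apply,
    Equiv.apply_symm_apply, ← Bilin.curry_symm_comp, sheafHomMap]
  simp

end InternalHom

end AlgebraicGeometry.Scheme.QCoh

/-! ### Extension of homomorphisms into an injective sheaf -/

namespace AlgebraicGeometry.Scheme.Modules

variable {X : Scheme.{u}}

instance : (sheafification X).PreservesMonomorphisms :=
  inferInstanceAs (PresheafOfModules.sheafification (𝟙 X.ringCatSheaf.obj)).PreservesMonomorphisms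

/-- An injective sheaf of modules is injective as a presheaf of modules, since sheafification
preserves monomorphisms. -/
lemma injective_val (E : X.Modules) [Injective E] :
    Injective ((toPresheafOfModules X).obj E) :=
  Injective.injective_of_adjoint (sheafificationAdjunction X) E

/-- The extension by zero of `A|_V`, as a subpresheaf of `A`: its sections over `W` are all
sections of `A` if `W ≤ V`, and zero otherwise. -/
noncomputable def extensionByZero (A : X.Modules) (V : X.Opens) :
    PresheafOfModules.Submodule A.val where
  obj W :=
    { carrier := { s | ¬ W.unop ≤ V → s = 0 }
      add_mem' hs ht h := by rw [hs h, ht h, add_zero]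
      zero_mem' _ := rfl
      smul_mem' r s hs h := by rw [hs h, smul_zero] }
  map {W W'} i s hs h := by
    have : s = 0 := hs fun h' ↦ h (i.unop.le.trans h')
    rw [this, _root_.map_zero]

namespace LocalHom

variable {A E : X.Modules} {V : X.Opens} (φ : LocalHom A E V)

open Classical in
/-- The maps `A(W) → E(W)` given by `φ` for `W ≤ V`, and by zero for all other `W`. -/
noncomputable def appOrZero (W : X.Opens) : Γ(A, W) →ₗ[Γ(X, W)] Γ(E, W) :=
  if h : W ≤ V then φ.app W h else 0

lemma appOrZero_of_le {W : X.Opens} (h : W ≤ V) : φ.appOrZero W = φ.app W h := dif_pos h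

lemma appOrZero_map {W W' : X.Opens} (i : W' ⟶ W) (s : Γ(A, W)) (hs : ¬ W ≤ V → s = 0) :
    φ.appOrZero W' (A.presheaf.map i.op s) = E.presheaf.map i.op (φ.appOrZero W s) := by
  by_cases h : W ≤ V
  · rw [φ.appOrZero_of_le h, φ.appOrZero_of_le (i.le.trans h), φ.app_map h i]
  · simp [hs h]

/-- The morphism from the extension by zero of `A|_V` to `E` given by a morphism `A|_V ⟶ E|_V`. -/
noncomputable def homOfExtensionByZero :
    (extensionByZero A V).toPresheafOfModules ⟶ (toPresheafOfModules X).obj E where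
  app W := ConcreteCategory.ofHom (C := ModuleCat (X.ringCatSheaf.obj.obj W))
    (X := (extensionByZero A V).toPresheafOfModules.obj W) (Y := E.val.obj W)
    { toFun s := φ.appOrZero W.unop s.1
      map_add' s t := map_add (φ.appOrZero W.unop) s.1 t.1
      map_smul' r s := LinearMap.map_smul (φ.appOrZero W.unop) r s.1 }
  naturality {W W'} i := by
    ext s
    exact φ.appOrZero_map i.unop s.1 s.2

/-- If `E` is injective, every morphism `A|_V ⟶ E|_V` extends to a morphism `A ⟶ E`. -/
lemma exists_hom [Injective E] :
    ∃ Φ : A ⟶ E, ∀ (W : X.Opens) (hW : W ≤ V) (a : Γ(A, W)), Φ.app W a = φ.app W hW a := by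
  have := injective_val E
  let i : (extensionByZero A V).toPresheafOfModules ⟶ (toPresheafOfModules X).obj A :=
    (extensionByZero A V).ι
  have : Mono i := (inferInstance : Mono (extensionByZero A V).ι)
  refine ⟨fullyFaithfulToPresheafOfModules.preimage
    (Injective.factorThru φ.homOfExtensionByZero i),
    fun W hW a ↦ ?_⟩
  have h := Injective.comp_factorThru φ.homOfExtensionByZero i
  have h' := congr(($h).app (op W) |>.hom
    (show (extensionByZero A V).obj (op W) from ⟨a, fun h' ↦ (h' hW).elim⟩))
  rw [← φ.appOrZero_of_le hW]
  exact h'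

end LocalHom

/-- If `E` is injective, the restriction maps of `sheafHom A E` are surjective. -/
lemma exists_map_eq_sheafHom {A E : X.Modules} [Injective E] {U V : X.Opens} (h : V ≤ U)
    (φ : Γ(sheafHom A E, V)) :
    ∃ ψ : Γ(sheafHom A E, U), (sheafHom A E).presheaf.map (homOfLE h).op ψ = φ := by
  obtain ⟨Φ, hΦ⟩ := (toLocalHom φ).exists_hom
  exact ⟨toLocalHom.symm ⟨fun W _ ↦ Φ.appₗ W, fun _ i a ↦ app_map Φ i a⟩,
    LocalHom.ext_apply fun W hW a ↦ hΦ W hW a⟩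

/-- For `E` injective and `f : A ⟶ B` a monomorphism, a morphism `A|_U ⟶ E|_U` extends first to a
morphism `A ⟶ E` and then along `f` to a morphism `B ⟶ E`. -/
lemma sheafHomMap_app_surjective {A B : X.Modules} (f : A ⟶ B) [Mono f] (E : X.Modules)
    [Injective E] (U : X.Opens) : Function.Surjective ((sheafHomMap f E).app U) := by
  intro φ
  obtain ⟨Φ, hΦ⟩ := (toLocalHom φ).exists_hom
  refine ⟨toLocalHom.symm ⟨fun W _ ↦ (Injective.factorThru Φ f).appₗ W,
    fun _ i a ↦ app_map (Injective.factorThru Φ f) i a⟩,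
    toLocalHom.injective (LocalHom.ext_apply fun W hW a ↦ ?_)⟩
  rw [toLocalHom_sheafHomMap, ← hΦ W hW]
  exact congr(($(Injective.comp_factorThru Φ f)).app W a)

end AlgebraicGeometry.Scheme.Modules

/-! ### Sheaves of finite type and quasicoherence of the sheaf of homomorphisms -/

/-- Morphisms of sheaves of modules which agree on generating sections are equal. -/
lemma SheafOfModules.GeneratingSections.hom_ext {C : Type*} [Category* C]
    {J : GrothendieckTopology C} {R : Sheaf J RingCat.{u}}
    [HasWeakSheafify J AddCommGrpCat.{u}] [J.WEqualsLocallyBijective AddCommGrpCat.{u}]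
    {M N : SheafOfModules.{u} R} (σ : M.GeneratingSections) {p q : M ⟶ N}
    (h : ∀ j, SheafOfModules.sectionsMap p (σ.s j) = SheafOfModules.sectionsMap q (σ.s j)) :
    p = q := by
  rw [← cancel_epi σ.π, SheafOfModules.freeHomEquiv_symm_comp,
    SheafOfModules.freeHomEquiv_symm_comp]
  exact congr(N.freeHomEquiv.symm $(funext h))

namespace AlgebraicGeometry.Scheme.Modules

variable {X : Scheme.{u}}

/-- Sections that generate `A` on the slice site over `W` restrict to generating sections of `A` on
each open subscheme `U ≤ W`. -/
noncomputable def generatingSectionsRestrict {A : X.Modules} {U W : X.Opens} (h : U ≤ W)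
    (σ : (SheafOfModules.over (R := X.ringCatSheaf) A W).GeneratingSections) :
    SheafOfModules.GeneratingSections (R := (U : Scheme.{u}).ringCatSheaf) (A.restrict U.ι) := by
  let u := X.homOfLE h
  let G : SheafOfModules.{u} (W : Scheme.{u}).ringCatSheaf ⥤
    SheafOfModules.{u} (U : Scheme.{u}).ringCatSheaf := restrictFunctor u
  have : PreservesColimitsOfSize.{u, u} G :=
    (inferInstance : PreservesColimitsOfSize.{u, u} (restrictFunctor u))
  let e : SheafOfModules.{u} (X.ringCatSheaf.over W) ≌
      SheafOfModules.{u} (W : Scheme.{u}).ringCatSheaf := overEquiv W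
  have : PreservesColimitsOfSize.{u, u} e.functor :=
    e.toAdjunction.leftAdjoint_preservesColimits
  let F : SheafOfModules.{u} (X.ringCatSheaf.over W) ⥤
    SheafOfModules.{u} (U : Scheme.{u}).ringCatSheaf := e.functor ⋙ G
  have : PreservesColimitsOfSize.{u, u} F := comp_preservesColimits _ _
  let iso : SheafOfModules.overFunctor X.ringCatSheaf _ ⋙ F ≅ restrictFunctor U.ι :=
    (Functor.associator _ _ _).symm ≪≫
        Functor.isoWhiskerRight (Scheme.Modules.overFunctorEquiv _) _ ≪≫
        (restrictFunctorComp _ _).symm ≪≫ (restrictFunctorCongr (by simp [u]))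
  exact SheafOfModules.GeneratingSections.equivOfIso (iso.app A)
    (σ.map F (Scheme.Modules.restrictUnitIso _).symm)

/-- The morphism `A|_U ⟶ E|_U` of sheaves on the open subscheme `U` given by `φ`. -/
noncomputable def LocalHom.toRestrict {A E : X.Modules} {U : X.Opens} (φ : LocalHom A E U) :
    A.restrict U.ι ⟶ E.restrict U.ι :=
  homMk (fun V ↦
    { toFun x := (E.restrictAppIso U.ι V).inv (φ.app (U.ι ''ᵁ V) (U.ι_image_le V)
        ((A.restrictAppIso U.ι V).hom x))
      map_add' x y := by simp
      map_smul' r x := by simp; rfl })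
    (fun i x ↦ by
      simp only [LinearMap.coe_mk, AddHom.coe_mk, map_restrictAppIso_hom_apply,
        restrictAppIso_inv_map_apply]
      exact congr((E.restrictAppIso U.ι _).inv $(φ.app_map (U.ι_image_le _) (homOfLE _) _)))

/-- A sheaf of finite type has, locally on affine opens `U`, finitely many sections over `U` such
that a morphism `A|_U ⟶ E|_U` that vanishes on them is zero. -/
lemma exists_generators {A : X.Modules} (hA : A.IsFiniteType) (x : X) :
    ∃ U : X.Opens, x ∈ U ∧ IsAffineOpen U ∧ ∃ (I : Type u) (_ : Finite I) (a : I → Γ(A, U)),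
      ∀ (E : X.Modules) (φ : LocalHom A E U), (∀ j, φ.app U le_rfl (a j) = 0) → φ = 0 := by
  obtain ⟨σ, hσ⟩ := hA.exists_localGeneratorsData
  obtain ⟨i, hi⟩ : ∃ i, x ∈ σ.X i := by
    have := (Opens.coversTop_iff _ _).1 σ.coversTop
    exact TopologicalSpace.Opens.mem_iSup.1 (this.ge trivial)
  obtain ⟨U, hU, hxU, hUi⟩ := TopologicalSpace.Opens.isBasis_iff_nbhd.mp X.isBasis_affineOpens hi
  change X.Opens at U
  let τ := generatingSectionsRestrict hUi (σ.generators i)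
  have hτ : Finite τ.I := (hσ.isFiniteType i).finite
  -- The top open of the subscheme `U` has image `U` in `X`, but not by definition.
  let a (j : τ.I) : Γ(A, U) := A.presheaf.map (homOfLE U.ι_image_top.ge).op
    ((A.restrictAppIso U.ι ⊤).hom ((τ.s j).val (op ⊤)))
  have ha (j : τ.I) (V : (U : Scheme.{u}).Opens) :
      (A.restrictAppIso U.ι V).hom ((τ.s j).val (op V)) =
        A.presheaf.map (homOfLE (U.ι_image_le V)).op (a j) := by
    rw [map_map A _ _ (homOfLE (U.ι.image_mono le_top))]
    exact ((τ.s j).property (homOfLE le_top : V ⟶ ⊤).op).symm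
  refine ⟨U, hxU, hU, τ.I, hτ, a, fun E φ h ↦ ?_⟩
  have hφ : φ.toRestrict = 0 := τ.hom_ext fun j ↦ by
    ext V
    change (E.restrictAppIso U.ι V.unop).inv (φ.app _ (U.ι_image_le V.unop)
      ((A.restrictAppIso U.ι V.unop).hom ((τ.s j).val V))) = 0
    rw [ha, φ.app_map le_rfl, h, map_zero, map_zero]
  refine LocalHom.ext_apply fun W hW b ↦ ?_
  obtain ⟨V, rfl⟩ : ∃ V : (U : Scheme.{u}).Opens, U.ι ''ᵁ V = W :=
    ⟨U.ι ⁻¹ᵁ W, by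
      rw [Hom.image_preimage_eq_opensRange_inf, Opens.opensRange_ι, inf_eq_right.2 hW]⟩
  exact congr(($hφ).app V b)

/-- If `E` is quasicoherent and injective and `A` is of finite type, then `Hom(A, E)` is
quasicoherent: the injectivity of `E` makes all restriction maps of `Hom(A, E)` surjective, and a
morphism `A|_U ⟶ E|_U` is determined by its values on finitely many generators of `A|_U`. -/
lemma isQuasicoherent_sheafHom {A E : X.Modules} [Injective E] (hA : A.IsFiniteType)
    (hE : isQuasicoherent X E) : isQuasicoherent X (sheafHom A E) := by
  refine isQuasicoherent_of_isLocalizingOn _ fun x ↦ ?_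
  obtain ⟨U, hxU, hU, I, _, a, ha⟩ := exists_generators hA x
  have hEU := IsLocalizingOn.of_isQuasicoherent hE hU
  refine ⟨U, hxU, hU, fun f s ↦ ?_, fun f t ht ↦ ?_⟩
  · obtain ⟨t, ht⟩ := exists_map_eq_sheafHom (X.basicOpen_le f) s
    exact ⟨0, t, by rw [ht, pow_zero, _root_.map_one, one_smul]⟩
  · have h (j : I) : ∃ n, f ^ n • (toLocalHom t).app U le_rfl (a j) = 0 := by
      refine hEU.exists_pow_smul_eq_zero f _ ?_
      rw [← (toLocalHom t).app_map]
      exact congr((toLocalHom $ht).app _ le_rfl _)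
    choose n hn using h
    cases nonempty_fintype I
    refine ⟨∑ j, n j, toLocalHom.injective (ha E _ fun j ↦ ?_)⟩
    obtain ⟨m, hm⟩ : ∃ m, ∑ j, n j = m + n j :=
      ⟨_, (Nat.sub_add_cancel (Finset.single_le_sum (fun _ _ ↦ Nat.zero_le _)
        (Finset.mem_univ j))).symm⟩
    have h1 (r : Γ(X, U)) : (toLocalHom (r • t)).app U le_rfl (a j) =
        r • (toLocalHom t).app U le_rfl (a j) := by
      rw [toLocalHom_smul, LocalHom.smul_app, show homOfLE le_rfl = 𝟙 U from rfl]
      simp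
    rw [h1, hm, pow_add, mul_smul, hn, smul_zero]

/-! ### Exactness of the internal hom -/

lemma epi_of_app_surjective {M N : X.Modules} (f : M ⟶ N)
    (h : ∀ U, Function.Surjective (f.app U)) : Epi f where
  left_cancellation g₁ g₂ h₁₂ := by
    ext U s
    obtain ⟨t, rfl⟩ := h U s
    exact congr(($h₁₂).app U t)

namespace Bilin

/-- Fixing `T`, a pairing `T × X₂ → E` is a morphism from `X₂` to the sheaf of homomorphisms from
`T` to `E`; if it vanishes on `X₁` it factors through the cokernel `X₃` of `X₁ ⟶ X₂`. -/
lemma exists_comp_eq {T E : X.Modules} {S : ShortComplex X.Modules} (hS : S.ShortExact)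
    (b : Bilin T S.X₂ E) (hb : b.comp (𝟙 T) S.f = curry.symm 0) :
    ∃ c : Bilin T S.X₃ E, c.comp (𝟙 T) S.g = b := by
  have := hS.epi_g
  have h : S.f ≫ b.flip.curry = 0 := by
    rw [← curry_comp]
    apply curry.symm.injective
    rw [Equiv.symm_apply_apply]
    exact congr(($hb).flip)
  refine ⟨(curry.symm (hS.exact.gIsCokernel.desc (CokernelCofork.ofπ _ h))).flip, ?_⟩
  have h' : S.g ≫ hS.exact.gIsCokernel.desc (CokernelCofork.ofπ _ h) = b.flip.curry :=
    hS.exact.gIsCokernel.fac _ WalkingParallelPair.one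
  have h'' := congr((curry.symm $h').flip)
  rw [curry_symm_comp, Equiv.symm_apply_apply] at h''
  exact h''

lemma comp_injective {T B C : X.Modules} (g : B ⟶ C) [Epi g] {E : X.Modules} :
    Function.Injective (fun c : Bilin T C E ↦ c.comp (𝟙 T) g) := by
  intro c d h
  have h' : c.flip.curry = d.flip.curry := by
    rw [← cancel_epi g, ← curry_comp, ← curry_comp]
    exact congr(($h).flip.curry)
  have h'' := congr((curry.symm $h').flip)
  rwa [Equiv.symm_apply_apply, Equiv.symm_apply_apply] at h''

end Bilin

end AlgebraicGeometry.Scheme.Modules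

namespace AlgebraicGeometry.Scheme.QCoh.InternalHom

open Modules

variable {X : Scheme.{u}} {E : X.QCoh}

lemma pairing_zero {A : X.QCoh} (H : InternalHom A E) {T : X.QCoh} :
    H.pairing (0 : T ⟶ H.obj) = Bilin.curry.symm 0 := by
  have : (0 : T ⟶ H.obj) = (0 : T ⟶ H.obj) ≫ 0 := by simp
  rw [this, pairing_comp]
  refine Bilin.ext_apply fun U s a ↦ ?_
  rw [Bilin.comp_app, Bilin.curry_symm_app]
  change (H.pairing 0).app U 0 _ = 0
  simp

lemma mono_map {S : ShortComplex X.QCoh} (hS : S.ShortExact)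
    (H₂ : InternalHom S.X₂ E) (H₃ : InternalHom S.X₃ E) : Mono (map S.g H₃ H₂) where
  right_cancellation {T} t t' h := by
    have := (shortExact_map_ι hS).epi_g
    apply H₃.pairing.injective
    apply Bilin.comp_injective (S.map (isQuasicoherent X).ι).g
    have := congr(H₂.pairing $h)
    rwa [pairing_comp_map, pairing_comp_map] at this

lemma exact_shortComplex {S : ShortComplex X.QCoh} (hS : S.ShortExact) (H₁ : InternalHom S.X₁ E)
    (H₂ : InternalHom S.X₂ E) (H₃ : InternalHom S.X₃ E) : (shortComplex S H₁ H₂ H₃).Exact := by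
  have := mono_map hS H₂ H₃
  have (T : X.QCoh) (t : T ⟶ H₂.obj) (ht : t ≫ map S.f H₂ H₁ = 0) :
      ∃ s, s ≫ map S.g H₃ H₂ = t := by
    have h := congr(H₁.pairing $ht)
    rw [pairing_zero, pairing_comp_map] at h
    obtain ⟨c, hc⟩ : ∃ c : Bilin T.obj S.X₃.obj E.obj,
        c.comp (𝟙 _) S.g.hom = H₂.pairing t :=
      Bilin.exists_comp_eq (shortExact_map_ι hS) (H₂.pairing t) h
    refine ⟨H₃.pairing.symm c, H₂.pairing.injective ?_⟩
    rw [pairing_comp_map, Equiv.apply_symm_apply, hc]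
  choose l hl using this
  exact ShortComplex.exact_of_f_is_kernel _
    (KernelFork.IsLimit.ofι _ _ (fun t ht ↦ l _ t ht) (fun t ht ↦ hl _ t ht) (fun t ht m hm ↦
      (cancel_mono (map S.g H₃ H₂)).1 (hm.trans (hl _ t ht).symm)))

/-- The map induced on sheaves of homomorphisms is surjective on sections, and the comparison
morphisms transfer this to arbitrary internal homs. -/
lemma epi_map {A B : X.QCoh} (f : A ⟶ B) [Mono f.hom] [Injective E.obj]
    (hA : isQuasicoherent X (sheafHom A.obj E.obj)) (hB : isQuasicoherent X (sheafHom B.obj E.obj))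
    (HB : InternalHom B E) (HA : InternalHom A E) : Epi (map f HB HA) := by
  have : Epi (ObjectProperty.homMk (sheafHomMap f.hom E.obj) :
      (⟨_, hB⟩ : X.QCoh) ⟶ ⟨_, hA⟩) :=
    (isQuasicoherent X).ι.epi_of_epi_map
      (epi_of_app_surjective (sheafHomMap f.hom E.obj) (sheafHomMap_app_surjective f.hom E.obj))
  exact epi_of_epi_fac (fromSheafHom_comp_map f hA hB HB HA)

end AlgebraicGeometry.Scheme.QCoh.InternalHom

open AlgebraicGeometry.Scheme AlgebraicGeometry.Scheme.Modules
  AlgebraicGeometry.Scheme.QCoh.InternalHom in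
theorem mainTheorem5 (X : AlgebraicGeometry.Scheme.{u}) (E : X.QCoh)
    (hE : Injective E) (hE' : Injective E.obj) :
    (∀ A : X.QCoh, A.obj.IsFiniteType →
      Nonempty (AlgebraicGeometry.Scheme.QCoh.InternalHom A E)) ∧
    ∀ S : ShortComplex X.QCoh, S.ShortExact →
      S.X₁.obj.IsFiniteType → S.X₂.obj.IsFiniteType → S.X₃.obj.IsFiniteType →
      ∀ (H₁ : AlgebraicGeometry.Scheme.QCoh.InternalHom S.X₁ E)
        (H₂ : AlgebraicGeometry.Scheme.QCoh.InternalHom S.X₂ E)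
        (H₃ : AlgebraicGeometry.Scheme.QCoh.InternalHom S.X₃ E),
        (AlgebraicGeometry.Scheme.QCoh.InternalHom.shortComplex S H₁ H₂ H₃).ShortExact := by
  have qc (A : X.QCoh) (hA : A.obj.IsFiniteType) : isQuasicoherent X (sheafHom A.obj E.obj) :=
    isQuasicoherent_sheafHom hA E.property
  refine ⟨fun A hA ↦ ⟨QCoh.internalHomOfSheafHom (qc A hA)⟩, fun S hS h₁ h₂ h₃ H₁ H₂ H₃ ↦ ?_⟩
  have : Mono S.f.hom := (QCoh.shortExact_map_ι hS).mono_f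
  exact
    { exact := exact_shortComplex hS H₁ H₂ H₃
      mono_f := mono_map hS H₂ H₃
      epi_g := epi_map S.f (qc _ h₁) (qc _ h₂) H₂ H₁ }
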